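/- Let $n,m\ge 0$ be integers and let $\mathcal E,\mathcal A\in\{0,*,?\}^{n\times n}$ and $\mathcal B\in\{0,*,?\}^{n\times m}$ be pattern matrices. Definitions. The pattern class $\mathcal P(\mathcal M)$ of a pattern matrix $\mathcal M$ is the set of real matrices $M$ of the same size with $M_{ij}=0$ whenever $\mathcal M_{ij}=0$ and $M_{ij}\neq 0$ whenever $\mathcal M_{ij}=*$ (entries $?$ are unrestricted). $\mathcal M$ has full row rank if every $M\in\mathcal P(\mathcal M)$ has full row rank. Pattern matrices are added entrywise, with $0+s=s+0=s$ for every symbol $s$ and $*+*=*+{?}={?}+*={?}+{?}={?}$. For real matrices $E,A\in\mathbb R^{n\times n}$ and $B\in\mathbb R^{n\times m}$, $(E,A,B)$ denotes the descriptor system $E\dot x(t)=Ax(t)+Bu(t)$, $t\ge 0$. It is regular if $\lambda E-A$ is invertible for some $\lambda\in\mathbb C$. For a regular system there are invertible real $Q,P$ with $QEP=\operatorname{diag}(I,N)$, $QAP=\operatorname{diag}(J,I)$ and $N$ nilpotent; the index $h$ is the least $k\ge 0$ with $N^k=0$ (so $h=0$ if $E$ is invertible). A state trajectory for the input $u$ is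 a function $x:[0,\infty)\to\mathbb R^n$ such that $Ex$ is continuous and, at every $t\ge 0$, has the right derivative $Ax(t)+Bu(t)$. A regular system is controllable if for all $T>0$ and $x_0,x_1\in\mathbb R^n$ there are an input $u:[0,\infty)\to\mathbb R^m$ that is $\max(h-1,0)$ times piecewise continuously differentiable (with values at breakpoints taken from the right) and a state trajectory $x$ for $u$ with $x(0)=x_0$ and $x(T)=x_1$. Theorem. (1) The rank conditions $$\operatorname{rank}\begin{bmatrix}E&B\end{bmatrix}=\operatorname{rank}\begin{bmatrix}A-\lambda E&B\end{bmatrix}=n$$ hold for all $\lambda\in\mathbb C$ and all $(E,A,B)\in\mathcal P(\mathcal E)\times\mathcal P(\mathcal A)\times\mathcal P(\mathcal B)$ if and only if the pattern matrices $$\begin{bmatrix}\mathcal E&\mathcal B\end{bmatrix},\qquad \begin{bmatrix}\mathcal A&\mathcal B\end{bmatrix},\qquad \begin{bmatrix}\mathcal A+\mathcal E&\mathcal B\end{bmatrix}$$ have full row rank. (2) If these three pattern matrices have full row rank, then the structured system $(\mathcal E,\mathcal A,\mathcal B)$ is regularly strongly structurally controllable: every regular system $(E,A,B)\in\mathcal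 P(\mathcal E)\times\mathcal P(\mathcal A)\times\mathcal P(\mathcal B)$ is controllable. -/

import Mathlib

open Set Filter Topology

/-- The symbols `0`, `*` (nonzero) and `?` (arbitrary). -/
inductive PatternSymbol : Type
  | zero
  | star
  | arb

/-- Addition of symbols: `0 + s = s + 0 = s`, and every other sum is `?`. -/
def PatternSymbol.add : PatternSymbol → PatternSymbol → PatternSymbol
  | .zero, s => s
  | s, .zero => s
  | _, _ => .arb

instance : Add PatternSymbol := ⟨PatternSymbol.add⟩

/-- Pattern matrices. Their sum is the entrywise sum of matrices, and `[𝓐 𝓑]` is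
`Matrix.fromCols 𝓐 𝓑`. -/
abbrev PatternMatrix (α β : Type) : Type := Matrix α β PatternSymbol

/-- The pattern class of a pattern matrix: a set of real matrices. -/
def patternClass {α β : Type} (P : PatternMatrix α β) : Set (Matrix α β ℝ) :=
  {M | ∀ i j, (P i j = .zero → M i j = 0) ∧ (P i j = .star → M i j ≠ 0)}

/-- A pattern matrix has full row rank if every matrix in its pattern class has. -/
def PatternMatrix.HasFullRowRank {α β : Type} [Fintype α] [Fintype β]
    (P : PatternMatrix α β) : Prop :=
  ∀ M ∈ patternClass P, M.rank = Fintype.card α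

/-- A real matrix viewed as a complex one. -/
noncomputable def complexify {α β : Type} (M : Matrix α β ℝ) : Matrix α β ℂ :=
  M.map (fun r : ℝ => (r : ℂ))

/-- `E ẋ = A x + B u` is regular if `l E - A` is invertible for some complex `l`. -/
def IsRegularPencil {n : ℕ} (E A : Matrix (Fin n) (Fin n) ℝ) : Prop :=
  ∃ l : ℂ, IsUnit (l • complexify E - complexify A)

/-- `(E, A)` has a Weierstrass form `Q E P = diag(I, N)`, `Q A P = diag(J, I)` with
`N ^ k = 0`, where `Q` and `P` are invertible real matrices. -/
def HasWeierstrassForm {n : ℕ} (E A : Matrix (Fin n) (Fin n) ℝ) (k : ℕ) : Prop :=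
  ∃ (r s : ℕ) (e : Fin r ⊕ Fin s ≃ Fin n) (Q P : Matrix (Fin n) (Fin n) ℝ)
    (J : Matrix (Fin r) (Fin r) ℝ) (N : Matrix (Fin s) (Fin s) ℝ),
    IsUnit Q ∧ IsUnit P ∧
    Q * E * P = Matrix.reindex e e (Matrix.fromBlocks 1 0 0 N) ∧
    Q * A * P = Matrix.reindex e e (Matrix.fromBlocks J 0 0 1) ∧
    N ^ k = 0

/-- The index of a regular pencil: the nilpotency index of the block `N` of its Weierstrass
form. It is `0` if `E` is invertible (the block `N` is then empty). -/
noncomputable def descriptorIndex {n : ℕ} (E A : Matrix (Fin n) (Fin n) ℝ) : ℕ :=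
  sInf {k | HasWeierstrassForm E A k}

/-- `u` is `k` times piecewise continuously differentiable on `[0, ∞)`: there are breakpoints
`0 = τ 0 < τ 1 < ⋯` tending to infinity such that `u` agrees on each `[τ i, τ (i + 1))` with
a function of class `C^k`. (At a breakpoint `u` takes its right limit.) -/
def IsPiecewiseContDiff {m : ℕ} (k : ℕ) (u : ℝ → Fin m → ℝ) : Prop :=
  ∃ τ : ℕ → ℝ, StrictMono τ ∧ τ 0 = 0 ∧ Tendsto τ atTop atTop ∧
    ∀ i, ∃ v : ℝ → Fin m → ℝ, ContDiff ℝ k v ∧ ∀ t ∈ Ico (τ i) (τ (i + 1)), u t = v t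

/-- `x` is a state trajectory of `E ẋ = A x + B u` on `[0, ∞)`: `E x` is continuous, and
`d/dt (E x) = A x + B u` at every time `t ≥ 0`. The derivative is the one from the right, since
`u` may jump; the equation is required at every `t`, so the algebraic constraints hold at every
time, the initial one included. -/
def IsStateTrajectory {n m : ℕ} (E A : Matrix (Fin n) (Fin n) ℝ) (B : Matrix (Fin n) (Fin m) ℝ)
    (u : ℝ → Fin m → ℝ) (x : ℝ → Fin n → ℝ) : Prop :=
  ContinuousOn (fun t => E.mulVec (x t)) (Ici 0) ∧
  ∀ t, 0 ≤ t →
    HasDerivWithinAt (fun s => E.mulVec (x s)) (A.mulVec (x t) + B.mulVec (u t)) (Ici t) t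

/-- Controllability of a regular system: every state is steered to every state in every positive
time by an input that is `h - 1` times piecewise continuously differentiable, `h` being the
index (piecewise continuous if `E` is invertible). -/
def IsControllableDescriptor {n m : ℕ} (E A : Matrix (Fin n) (Fin n) ℝ)
    (B : Matrix (Fin n) (Fin m) ℝ) : Prop :=
  ∀ T : ℝ, 0 < T → ∀ x₀ x₁ : Fin n → ℝ,
    ∃ u : ℝ → Fin m → ℝ, IsPiecewiseContDiff (descriptorIndex E A - 1) u ∧
      ∃ x : ℝ → Fin n → ℝ, IsStateTrajectory E A B u x ∧ x 0 = x₀ ∧ x T = x₁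

/-- Every regular system in the pattern classes is controllable. -/
def IsRegularlyStronglyStructurallyControllable {n m : ℕ}
    (PE PA : PatternMatrix (Fin n) (Fin n)) (PB : PatternMatrix (Fin n) (Fin m)) : Prop :=
  ∀ E ∈ patternClass PE, ∀ A ∈ patternClass PA, ∀ B ∈ patternClass PB,
    IsRegularPencil E A → IsControllableDescriptor E A B

/-! For `l = 0` the second rank condition concerns `[𝓐 𝓑]`; for `l ≠ 0` the matrix `A - l E`
complies with `𝓐 + 𝓔`, and with `l = 1` every real matrix in that class occurs. Complex `l` is
handled by transferring full row rank from real to complex matrices.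

For controllability, the second rank condition gives `L = [s E - A, -B]` a polynomial right inverse
`R`. With `D = d/dt`, every polynomial `g` then yields an exact solution `g - R(D) L(D) g`. Since
`[E B]` is onto, approximate solutions of any order with prescribed state exist near `0` and `T`. If
`g` matches them there to high order, the correction vanishes at both times. -/

theorem rank_eq_card_iff_vecMul {K α β : Type*} [Field K] [Fintype α] [Fintype β]
    (M : Matrix α β K) :
    M.rank = Fintype.card α ↔ ∀ z : α → K, Matrix.vecMul z M = 0 → z = 0 := by
  rw [Matrix.rank_eq_finrank_span_row, eq_comm]
  have h := linearIndependent_iff_card_eq_finrank_span (R := K) (b := M.row)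
  rw [Set.finrank] at h
  rw [← h, ← Matrix.vecMul_injective_iff]
  exact injective_iff_map_eq_zero M.vecMulLinear

/-! ### Full row rank: from real to complex matrices. -/

/-- For `c ≠ 0`, at most one real `a` makes `Re + a Im` vanish at `c`. -/
theorem exists_realFunctional_ne_zero (s : Finset ℂ) (hs : (0 : ℂ) ∉ s) :
    ∃ φ : ℂ →ₗ[ℝ] ℝ, ∀ c ∈ s, φ c ≠ 0 := by
  obtain ⟨a, ha⟩ := Infinite.exists_notMem_finset (s.image fun c => -c.re / c.im)
  refine ⟨Complex.reLm + a • Complex.imLm, fun c hc h => ?_⟩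
  simp only [LinearMap.add_apply, LinearMap.smul_apply, Complex.reLm_coe, Complex.imLm_coe,
    smul_eq_mul] at h
  by_cases hi : c.im = 0
  · have hr : c.re = 0 := by simpa [hi] using h
    exact hs (by rwa [← Complex.ext (z := c) (w := 0) hr hi])
  · exact ha (Finset.mem_image.2 ⟨c, hc, by field_simp; linarith⟩)

/-- The complex matrices that comply with a pattern matrix. -/
def complexPatternClass {α β : Type} (P : PatternMatrix α β) : Set (Matrix α β ℂ) :=
  {M | ∀ i j, (P i j = .zero → M i j = 0) ∧ (P i j = .star → M i j ≠ 0)}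

/-- A full row rank pattern matrix also has full row rank over the complex numbers: a left null
vector of a complex matrix is turned into one of a real matrix by a generic real functional. -/
theorem PatternMatrix.HasFullRowRank.vecMul_complex_eq_zero {α β : Type} [Fintype α] [Fintype β]
    {P : PatternMatrix α β} (hP : P.HasFullRowRank) {M : Matrix α β ℂ}
    (hM : M ∈ complexPatternClass P) {z : α → ℂ} (hz : Matrix.vecMul z M = 0) : z = 0 := by
  classical
  -- Scaling the rows by nonzero numbers preserves the zero pattern; on the support of `z` the scale
  -- is `z` itself, so the indicator of the support becomes a left null vector.
  let y : α → ℂ := fun i => if z i = 0 then 1 else z i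
  have hy : ∀ i, y i ≠ 0 := fun i => by by_cases h : z i = 0 <;> simp [y, h]
  obtain ⟨φ, hφ⟩ := exists_realFunctional_ne_zero
    ((Finset.univ.image fun p : α × β => y p.1 * M p.1 p.2).erase 0) (by simp)
  have hne : ∀ i j, M i j ≠ 0 → φ (y i * M i j) ≠ 0 := fun i j h =>
    hφ _ (Finset.mem_erase.2 ⟨mul_ne_zero (hy i) h,
      Finset.mem_image.2 ⟨(i, j), Finset.mem_univ _, rfl⟩⟩)
  have hR : (fun i j => φ (y i * M i j) : Matrix α β ℝ) ∈ patternClass P := fun i j =>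
    ⟨fun h => by simp [(hM i j).1 h], fun h => hne i j ((hM i j).2 h)⟩
  have h0 := (rank_eq_card_iff_vecMul _).1 (hP _ hR) (fun i => if z i = 0 then 0 else 1) <| by
    funext j
    have hj : ∑ i, z i * M i j = 0 := congrFun hz j
    simp only [Matrix.vecMul, dotProduct, Pi.zero_apply]
    refine Eq.trans (Finset.sum_congr rfl fun i _ => ?_)
      ((map_sum φ _ _).symm.trans ((congrArg φ hj).trans (map_zero φ)))
    by_cases h : z i = 0
    · simp only [if_true, zero_mul, h, map_zero]
    · simp only [y, if_neg h, one_mul]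
  funext i
  by_contra h
  simpa [show z i ≠ 0 from h] using congrFun h0 i

/-! ### Pattern classes and the rank criterion. -/

theorem patternClass_nonempty {α β : Type} (P : PatternMatrix α β) : (patternClass P).Nonempty := by
  classical
  refine ⟨fun i j => if P i j = .zero then 0 else 1, fun i j => ⟨fun h => ?_, fun h => ?_⟩⟩
  · simp [h]
  · simp [h]

theorem fromCols_toCols_mem_patternClass {α β γ : Type} {P : PatternMatrix α β}
    {Q : PatternMatrix α γ} {M : Matrix α (β ⊕ γ) ℝ}
    (hM : M ∈ patternClass (Matrix.fromCols P Q)) :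
    M.toCols₁ ∈ patternClass P ∧ M.toCols₂ ∈ patternClass Q :=
  ⟨fun i j => hM i (.inl j), fun i j => hM i (.inr j)⟩

theorem fromCols_mem_patternClass {α β γ : Type} {P : PatternMatrix α β}
    {Q : PatternMatrix α γ} {M : Matrix α β ℝ} {N : Matrix α γ ℝ}
    (hM : M ∈ patternClass P) (hN : N ∈ patternClass Q) :
    Matrix.fromCols M N ∈ patternClass (Matrix.fromCols P Q) := by
  rintro i (j | j)
  exacts [hM i j, hN i j]

theorem complexify_mem_complexPatternClass {α β : Type} {P : PatternMatrix α β}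
    {M : Matrix α β ℝ} (hM : M ∈ patternClass P) : complexify M ∈ complexPatternClass P := by
  intro i j
  simpa [complexify] using hM i j

theorem fromCols_mem_complexPatternClass {α β γ : Type} {P : PatternMatrix α β}
    {Q : PatternMatrix α γ} {M : Matrix α β ℂ} {N : Matrix α γ ℂ}
    (hM : M ∈ complexPatternClass P) (hN : N ∈ complexPatternClass Q) :
    Matrix.fromCols M N ∈ complexPatternClass (Matrix.fromCols P Q) := by
  rintro i (j | j)
  exacts [hM i j, hN i j]

theorem sub_smul_mem_complexPatternClass {α β : Type} {P Q : PatternMatrix α β}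
    {M N : Matrix α β ℂ} (hM : M ∈ complexPatternClass P) (hN : N ∈ complexPatternClass Q)
    {l : ℂ} (hl : l ≠ 0) : M - l • N ∈ complexPatternClass (P + Q) := by
  intro i j
  have h1 := hM i j
  have h2 := hN i j
  have hadd : (P + Q) i j = PatternSymbol.add (P i j) (Q i j) := rfl
  rw [hadd]
  cases hp : P i j <;> cases hq : Q i j <;> simp_all [PatternSymbol.add]

theorem exists_sub_mem_patternClass {α β : Type} {P Q : PatternMatrix α β} {M : Matrix α β ℝ}
    (hM : M ∈ patternClass (P + Q)) :
    ∃ A ∈ patternClass P, ∃ E ∈ patternClass Q, A - E = M := by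
  have key : ∀ i j, ∃ a e : ℝ, ((P i j = .zero → a = 0) ∧ (P i j = .star → a ≠ 0)) ∧
      ((Q i j = .zero → e = 0) ∧ (Q i j = .star → e ≠ 0)) ∧ a - e = M i j := by
    intro i j
    have h := hM i j
    have hadd : (P + Q) i j = PatternSymbol.add (P i j) (Q i j) := rfl
    rw [hadd] at h
    -- Then `e` and `M i j + e` are both nonzero, hence allowed by any pair of symbols other than
    -- `0`.
    obtain ⟨e, he⟩ := Infinite.exists_notMem_finset ({0, -M i j} : Finset ℝ)
    simp only [Finset.mem_insert, Finset.mem_singleton, not_or] at he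
    cases hp : P i j
    · refine ⟨0, -M i j, ?_⟩
      cases hq : Q i j <;> simp_all [PatternSymbol.add]
    all_goals
      cases hq : Q i j
      · refine ⟨M i j, 0, ?_⟩
        simp_all [PatternSymbol.add]
      all_goals
        refine ⟨M i j + e, e, ?_⟩
        have : M i j + e ≠ 0 := fun h => he.2 (by linarith)
        simp_all
  choose A E h1 h2 h3 using key
  exact ⟨A, h1, E, h2, by ext i j; exact h3 i j⟩

theorem rank_complexify_of_rank {α β : Type} [Fintype α] [Fintype β] {M : Matrix α β ℝ} :
    (complexify M).rank = Fintype.card α → M.rank = Fintype.card α := by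
  rw [rank_eq_card_iff_vecMul, rank_eq_card_iff_vecMul]
  intro h z hz
  have := h (fun i => (z i : ℂ)) <| by
    funext j
    have hj : ∑ i, z i * M i j = 0 := congrFun hz j
    simp only [Matrix.vecMul, dotProduct, complexify, Matrix.map_apply, Pi.zero_apply]
    exact_mod_cast hj
  funext i
  exact Complex.ofReal_eq_zero.1 (congrFun this i)

theorem complexify_fromCols {α β γ : Type} (M : Matrix α β ℝ) (N : Matrix α γ ℝ) :
    complexify (Matrix.fromCols M N) = Matrix.fromCols (complexify M) (complexify N) := by
  ext i (j | j) <;> rfl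

theorem rank_conditions_iff_hasFullRowRank (n m : ℕ) (PE PA : PatternMatrix (Fin n) (Fin n))
    (PB : PatternMatrix (Fin n) (Fin m)) :
    (∀ E ∈ patternClass PE, ∀ A ∈ patternClass PA, ∀ B ∈ patternClass PB, ∀ l : ℂ,
        (Matrix.fromCols E B).rank = n ∧
        (Matrix.fromCols (complexify A - l • complexify E) (complexify B)).rank = n) ↔
      (PatternMatrix.HasFullRowRank (Matrix.fromCols PE PB) ∧
       PatternMatrix.HasFullRowRank (Matrix.fromCols PA PB) ∧
       PatternMatrix.HasFullRowRank (Matrix.fromCols (PA + PE) PB)) := by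
  constructor
  · intro h
    obtain ⟨E₀, hE₀⟩ := patternClass_nonempty PE
    obtain ⟨A₀, hA₀⟩ := patternClass_nonempty PA
    refine ⟨fun M hM => ?_, fun M hM => ?_, fun M hM => ?_⟩
    all_goals obtain ⟨h1, h2⟩ := fromCols_toCols_mem_patternClass hM
    · have := (h _ h1 _ hA₀ _ h2 0).1
      rw [Matrix.fromCols_toCols] at this
      exact this.trans (Fintype.card_fin n).symm
    · have := (h _ hE₀ _ h1 _ h2 0).2
      rw [zero_smul, sub_zero, ← complexify_fromCols, Matrix.fromCols_toCols] at this
      exact rank_complexify_of_rank (by simpa using this)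
    · obtain ⟨A, hA, E, hE, hAE⟩ := exists_sub_mem_patternClass h1
      have := (h _ hE _ hA _ h2 1).2
      have hc : complexify A - (1 : ℂ) • complexify E = complexify M.toCols₁ := by
        rw [← hAE]
        ext i j
        simp [complexify]
      rw [hc, ← complexify_fromCols, Matrix.fromCols_toCols] at this
      exact rank_complexify_of_rank (by simpa using this)
  · rintro ⟨hE', hA', hS'⟩ E hE A hA B hB l
    refine ⟨by simpa using hE' _ (fromCols_mem_patternClass hE hB), ?_⟩
    have hcB := complexify_mem_complexPatternClass hB
    have hcA := complexify_mem_complexPatternClass hA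
    have hcE := complexify_mem_complexPatternClass hE
    refine Eq.trans ((rank_eq_card_iff_vecMul _).2 fun z hz => ?_) (Fintype.card_fin n)
    by_cases hl : l = 0
    · rw [hl, zero_smul, sub_zero] at hz
      exact hA'.vecMul_complex_eq_zero (fromCols_mem_complexPatternClass hcA hcB) hz
    · exact hS'.vecMul_complex_eq_zero (fromCols_mem_complexPatternClass
        (sub_smul_mem_complexPatternClass hcA hcE hl) hcB) hz

/-! ### Right inverses of polynomial matrices. -/

open Polynomial in
/-- A real polynomial matrix whose values at all complex numbers have full row rank has a
polynomial right inverse. -/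
theorem exists_right_inverse_of_vecMul_aeval {α β : Type*} [Fintype α] [Fintype β] [DecidableEq α]
    (L : Matrix α β ℝ[X])
    (hL : ∀ (l : ℂ) (z : α → ℂ), Matrix.vecMul z (L.map (aeval l)) = 0 → z = 0) :
    ∃ R : Matrix β α ℝ[X], L * R = 1 := by
  classical
  rw [← Matrix.mulVec_surjective_iff_exists_right_inverse]
  change Function.Surjective L.mulVecLin
  rw [← LinearMap.range_eq_top]
  -- A proper column span lies in a maximal submodule, with quotient a field `ℝ[X] ⧸ I` finite over
  -- `ℝ`, which embeds in `ℂ`. At the image of `X`, the images of the basis vectors form a left null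
  -- vector.
  refine (IsCoatomic.eq_top_or_exists_le_coatom _).resolve_right ?_
  rintro ⟨N, hN, hle⟩
  obtain ⟨I, hI, ⟨e⟩⟩ := isSimpleModule_iff_quot_maximal.1 (isSimpleModule_iff_isCoatom.2 hN)
  let _ : Field (ℝ[X] ⧸ I) := Ideal.Quotient.field I
  have : Module.Finite ℝ (ℝ[X] ⧸ I) := finite_of_finite_type_of_isJacobsonRing ℝ (ℝ[X] ⧸ I)
  let σ : (ℝ[X] ⧸ I) →ₐ[ℝ] ℂ := IsAlgClosed.lift
  let φ : (α → ℝ[X]) →ₗ[ℝ[X]] ℝ[X] ⧸ I := e.toLinearMap ∘ₗ N.mkQ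
  have hker : ∀ v, φ v = 0 ↔ v ∈ N := fun v => by simp [φ]
  have hφ : ∀ v, φ v = ∑ i, φ (Pi.single i 1) * Ideal.Quotient.mk I (v i) := fun v => by
    conv_lhs => rw [pi_eq_sum_univ' v, map_sum]
    refine Finset.sum_congr rfl fun i _ => ?_
    rw [map_smul, mul_comm]
    rfl
  have hσ : ∀ p : ℝ[X], aeval (σ (Ideal.Quotient.mk I X)) p = σ (Ideal.Quotient.mk I p) := by
    intro p
    have := DFunLike.congr_fun (Polynomial.algHom_ext
      (f := aeval (σ (Ideal.Quotient.mk I X))) (g := σ.comp (Ideal.Quotient.mkₐ ℝ I)) (by simp)) p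
    simpa using this
  have hz := hL (σ (Ideal.Quotient.mk I X)) (fun i => σ (φ (Pi.single i 1))) <| by
    funext j
    have hcol : φ (fun i => L i j) = 0 := by
      refine (hker _).2 (hle ⟨Pi.single j 1, ?_⟩)
      simp [Matrix.col]
      rfl
    rw [hφ] at hcol
    simpa [Matrix.vecMul, dotProduct, hσ] using congrArg σ hcol
  refine hN.1 (eq_top_iff.2 fun v _ => (hker v).1 ?_)
  rw [hφ]
  refine Finset.sum_eq_zero fun i _ => ?_
  have : φ (Pi.single i 1) = 0 := σ.toRingHom.injective (by simpa using congrFun hz i)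
  rw [this, zero_mul]

/-! ### Constant-coefficient differential operators and orders of vanishing. -/

open Polynomial in
/-- The differential operator `L(d/dt)` of a polynomial matrix, on vectors of polynomials. -/
noncomputable def polyDiffOp {α β : Type*} [Fintype β] (L : Matrix α β ℝ[X]) :
    (β → ℝ[X]) →ₗ[ℝ] (α → ℝ[X]) :=
  LinearMap.pi fun i => ∑ j, (aeval (derivative : ℝ[X] →ₗ[ℝ] ℝ[X]) (L i j)) ∘ₗ LinearMap.proj j

section
open Polynomial

theorem polyDiffOp_apply {α β : Type*} [Fintype β] (L : Matrix α β ℝ[X]) (w : β → ℝ[X]) (i : α) :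
    polyDiffOp L w i = ∑ j, aeval (derivative : ℝ[X] →ₗ[ℝ] ℝ[X]) (L i j) (w j) := by
  simp [polyDiffOp]

theorem polyDiffOp_mul {α β γ : Type*} [Fintype β] [Fintype γ] (L : Matrix α β ℝ[X])
    (R : Matrix β γ ℝ[X]) (w : γ → ℝ[X]) :
    polyDiffOp (L * R) w = polyDiffOp L (polyDiffOp R w) := by
  ext1 i
  simp only [polyDiffOp_apply, Matrix.mul_apply, map_sum, map_mul, LinearMap.sum_apply,
    Module.End.mul_apply]
  exact Finset.sum_comm

theorem polyDiffOp_one {α : Type*} [Fintype α] [DecidableEq α] (w : α → ℝ[X]) :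
    polyDiffOp (1 : Matrix α α ℝ[X]) w = w := by
  ext1 i
  rw [polyDiffOp_apply, Finset.sum_eq_single i]
  · simp
  · intro j _ hj
    simp [Matrix.one_apply_ne hj.symm]
  · simp

theorem pow_dvd_iterate_derivative {c : ℝ} {k : ℕ} (j : ℕ) {f : ℝ[X]}
    (h : (X - C c) ^ (j + k) ∣ f) : (X - C c) ^ k ∣ derivative^[j] f := by
  simpa using pow_sub_dvd_iterate_derivative_of_pow_dvd j h

theorem pow_dvd_aeval_derivative {c : ℝ} {N k : ℕ} {p f : ℝ[X]} (hp : p.natDegree ≤ N)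
    (h : (X - C c) ^ (N + k) ∣ f) :
    (X - C c) ^ k ∣ aeval (derivative : ℝ[X] →ₗ[ℝ] ℝ[X]) p f := by
  rw [aeval_eq_sum_range, LinearMap.sum_apply]
  refine Finset.dvd_sum fun j hj => ?_
  rw [LinearMap.smul_apply, Module.End.pow_apply]
  have hjN : j ≤ N := (Nat.lt_succ_iff.1 (Finset.mem_range.1 hj)).trans hp
  rw [smul_eq_C_mul]
  exact (pow_dvd_iterate_derivative j ((pow_dvd_pow _ (by omega)).trans h)).mul_left _

/-- An operator of order at most `N` lowers the order of vanishing by at most `N`, at every point.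
-/
theorem exists_pow_dvd_polyDiffOp {α β : Type*} [Finite α] [Fintype β] (L : Matrix α β ℝ[X]) :
    ∃ N : ℕ, ∀ (c : ℝ) (k : ℕ) (w : β → ℝ[X]), (∀ j, (X - C c) ^ (N + k) ∣ w j) →
      ∀ i, (X - C c) ^ k ∣ polyDiffOp L w i := by
  have := Fintype.ofFinite α
  refine ⟨Finset.univ.sup fun p : α × β => (L p.1 p.2).natDegree, fun c k w hw i => ?_⟩
  rw [polyDiffOp_apply]
  exact Finset.dvd_sum fun j _ => pow_dvd_aeval_derivative
    (Finset.le_sup (f := fun p : α × β => (L p.1 p.2).natDegree) (Finset.mem_univ (i, j))) (hw j)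

/-- Chinese remaindering: jets at two distinct points can be prescribed independently. -/
theorem exists_pow_dvd_sub_and_pow_dvd_sub {c d : ℝ} (hcd : c ≠ d) (M : ℕ) (a b : ℝ[X]) :
    ∃ g : ℝ[X], (X - C c) ^ M ∣ g - a ∧ (X - C d) ^ M ∣ g - b := by
  have hco : IsCoprime ((X - C c) ^ M) ((X - C d) ^ M) :=
    (isCoprime_X_sub_C_of_isUnit_sub (sub_ne_zero.2 hcd).isUnit).pow
  obtain ⟨u, v, huv⟩ := hco
  refine ⟨a + (b - a) * (u * (X - C c) ^ M), ⟨(b - a) * u, by ring⟩, ⟨(a - b) * v, ?_⟩⟩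
  linear_combination (b - a) * huv

/-! ### Polynomial solutions of the descriptor system. -/

/-- The polynomial matrix `[s E - A, -B]` of a descriptor system. -/
noncomputable def pencilMatrix {n m : ℕ} (E A : Matrix (Fin n) (Fin n) ℝ)
    (B : Matrix (Fin n) (Fin m) ℝ) : Matrix (Fin n) (Fin n ⊕ Fin m) ℝ[X] :=
  Matrix.fromCols (Matrix.of fun i j => C (E i j) * X - C (A i j)) (Matrix.of fun i j => -C (B i j))

theorem polyDiffOp_pencilMatrix {n m : ℕ} (E A : Matrix (Fin n) (Fin n) ℝ)
    (B : Matrix (Fin n) (Fin m) ℝ) (w : Fin n ⊕ Fin m → ℝ[X]) (i : Fin n) :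
    polyDiffOp (pencilMatrix E A B) w i =
      ∑ j, C (E i j) * derivative (w (.inl j)) - ∑ j, C (A i j) * w (.inl j)
        - ∑ j, C (B i j) * w (.inr j) := by
  rw [polyDiffOp_apply, Fintype.sum_sum_type, sub_eq_add_neg, ← Finset.sum_neg_distrib,
    ← Finset.sum_sub_distrib]
  congr 1 <;> refine Finset.sum_congr rfl fun j _ => ?_ <;>
    simp [pencilMatrix, Module.algebraMap_end_apply, smul_eq_C_mul]

/-- Approximate polynomial solutions of a descriptor system near a point, to any order and with
any given value. -/
theorem exists_pow_dvd_polyDiffOp_pencilMatrix {n m : ℕ} (E A : Matrix (Fin n) (Fin n) ℝ)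
    (B : Matrix (Fin n) (Fin m) ℝ)
    (hEB : ∀ v : Fin n → ℝ, ∃ x y, E.mulVec x - B.mulVec y = v) (c : ℝ) (ξ : Fin n → ℝ) (K : ℕ) :
    ∃ w : Fin n ⊕ Fin m → ℝ[X], (∀ i, eval c (w (.inl i)) = ξ i) ∧
      ∀ i, (X - C c) ^ K ∣ polyDiffOp (pencilMatrix E A B) w i := by
  induction K with
  | zero => exact ⟨Sum.elim (fun i => C (ξ i)) 0, by simp, by simp⟩
  | succ K ih =>
    obtain ⟨w, hw, hd⟩ := ih
    choose r hr using hd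
    -- The choice cancels the residual's coefficient at `(X - c)^K`: `E x` enters through a
    -- derivative, whence the degree `K + 1` and the division by `K + 1`, while the `A` term already
    -- has order `K + 1`.
    obtain ⟨x, y, hxy⟩ := hEB fun i => -eval c (r i)
    refine ⟨w + Sum.elim (fun j => C (x j / (K + 1)) * (X - C c) ^ (K + 1))
      (fun j => C (y j) * (X - C c) ^ K), by simp [hw], fun i => ?_⟩
    have hK : (K + 1 : ℝ) ≠ 0 := by positivity
    have hi : ∑ j, C (E i j) * C (x j) - ∑ j, C (B i j) * C (y j) = -C (eval c (r i)) := by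
      have := congrArg C (congrFun hxy i)
      simpa [Matrix.mulVec, dotProduct, map_sum] using this
    have hdx : ∀ j, derivative (C (x j / (K + 1)) * (X - C c) ^ (K + 1)) =
        C (x j) * (X - C c) ^ K := by
      intro j
      rw [derivative_C_mul, derivative_X_sub_C_pow, ← mul_assoc, Nat.add_sub_cancel,
        ← C_mul]
      congr 2
      push_cast
      field_simp
    obtain ⟨q, hq⟩ : X - C c ∣ r i - C (eval c (r i)) := X_sub_C_dvd_sub_C_eval
    rw [map_add, Pi.add_apply, hr, polyDiffOp_pencilMatrix]
    simp only [Sum.elim_inl, Sum.elim_inr, hdx, ← mul_assoc]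
    rw [← Finset.sum_mul, ← Finset.sum_mul, ← Finset.sum_mul]
    refine ⟨q - ∑ j, C (A i j) * C (x j / (K + 1)), ?_⟩
    linear_combination (X - C c) ^ K * hi + (X - C c) ^ K * hq

theorem exists_polyDiffOp_pencilMatrix_eq_zero {n m : ℕ} (E A : Matrix (Fin n) (Fin n) ℝ)
    (B : Matrix (Fin n) (Fin m) ℝ)
    (hEB : ∀ v : Fin n → ℝ, ∃ x y, E.mulVec x - B.mulVec y = v)
    {R : Matrix (Fin n ⊕ Fin m) (Fin n) ℝ[X]} (hR : pencilMatrix E A B * R = 1)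
    {c d : ℝ} (hcd : c ≠ d) (ξ η : Fin n → ℝ) :
    ∃ w : Fin n ⊕ Fin m → ℝ[X], polyDiffOp (pencilMatrix E A B) w = 0 ∧
      (∀ i, eval c (w (.inl i)) = ξ i) ∧ ∀ i, eval d (w (.inl i)) = η i := by
  set L := pencilMatrix E A B
  obtain ⟨N, hN⟩ := exists_pow_dvd_polyDiffOp L
  obtain ⟨N', hN'⟩ := exists_pow_dvd_polyDiffOp R
  obtain ⟨a, ha, hLa⟩ := exists_pow_dvd_polyDiffOp_pencilMatrix E A B hEB c ξ (N' + 1)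
  obtain ⟨b, hb, hLb⟩ := exists_pow_dvd_polyDiffOp_pencilMatrix E A B hEB d η (N' + 1)
  -- `L(D)` costs `N` orders of vanishing and `R(D)` costs `N'`; the last one makes the correction
  -- vanish at the point.
  choose g hga hgb using fun j =>
    exists_pow_dvd_sub_and_pow_dvd_sub hcd (N + (N' + 1)) (a j) (b j)
  have key : ∀ (e : ℝ) (f : Fin n ⊕ Fin m → ℝ[X]), (∀ j, (X - C e) ^ (N + (N' + 1)) ∣ g j - f j) →
      (∀ i, (X - C e) ^ (N' + 1) ∣ polyDiffOp L f i) →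
      ∀ j, eval e ((g - polyDiffOp R (polyDiffOp L g)) j) = eval e (f j) := by
    intro e f hf hLf j
    have h1 : ∀ i, (X - C e) ^ (N' + 1) ∣ polyDiffOp L g i := fun i => by
      have := dvd_add (hN e (N' + 1) (g - f) hf i) (hLf i)
      rwa [map_sub, Pi.sub_apply, sub_add_cancel] at this
    have h2 := hN' e 1 _ h1 j
    rw [pow_one, dvd_iff_isRoot, IsRoot.def] at h2
    have h3 := (dvd_pow_self _ (by omega)).trans (hf j)
    rw [dvd_iff_isRoot, IsRoot.def, eval_sub, sub_eq_zero] at h3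
    rw [Pi.sub_apply, eval_sub, h2, h3, sub_zero]
  refine ⟨g - polyDiffOp R (polyDiffOp L g), ?_, fun i => ?_, fun i => ?_⟩
  · rw [map_sub, ← polyDiffOp_mul, hR, polyDiffOp_one, sub_self]
  · rw [key c a hga hLa, ha]
  · rw [key d b hgb hLb, hb]

theorem exists_pencilMatrix_mul_eq_one {n m : ℕ} (E A : Matrix (Fin n) (Fin n) ℝ)
    (B : Matrix (Fin n) (Fin m) ℝ)
    (h : ∀ l : ℂ, (Matrix.fromCols (complexify A - l • complexify E) (complexify B)).rank = n) :
    ∃ R : Matrix (Fin n ⊕ Fin m) (Fin n) ℝ[X], pencilMatrix E A B * R = 1 := by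
  refine exists_right_inverse_of_vecMul_aeval _ fun l z hz => ?_
  refine (rank_eq_card_iff_vecMul _).1 ((h l).trans (Fintype.card_fin n).symm) z ?_
  have : (pencilMatrix E A B).map (aeval l) =
      -Matrix.fromCols (complexify A - l • complexify E) (complexify B) := by
    ext i (j | j)
    · simp [pencilMatrix, complexify, mul_comm l]
    · simp [pencilMatrix, complexify]
  rwa [this, Matrix.vecMul_neg, neg_eq_zero] at hz

end

/-! ### From polynomial solutions to controllability. -/

theorem exists_mulVec_sub_mulVec {n m : ℕ} {E : Matrix (Fin n) (Fin n) ℝ}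
    {B : Matrix (Fin n) (Fin m) ℝ} (h : (Matrix.fromCols E B).rank = n) (v : Fin n → ℝ) :
    ∃ x y, E.mulVec x - B.mulVec y = v := by
  have htop : (Matrix.fromCols E B).mulVecLin.range = ⊤ :=
    Submodule.eq_top_of_finrank_eq (h.trans (by simp))
  obtain ⟨w, hw⟩ := LinearMap.range_eq_top.1 htop v
  refine ⟨w ∘ Sum.inl, -(w ∘ Sum.inr), ?_⟩
  rw [Matrix.mulVec_neg, sub_neg_eq_add, ← hw, Matrix.mulVecLin_apply, Matrix.fromCols_mulVec]

theorem isPiecewiseContDiff_of_contDiff {m k : ℕ} {u : ℝ → Fin m → ℝ} (hu : ContDiff ℝ k u) :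
    IsPiecewiseContDiff k u :=
  ⟨fun i => (i : ℝ), Nat.strictMono_cast, Nat.cast_zero, tendsto_natCast_atTop_atTop,
    fun _ => ⟨u, hu, fun _ _ => rfl⟩⟩

theorem isStateTrajectory_eval {n m : ℕ} {E A : Matrix (Fin n) (Fin n) ℝ}
    {B : Matrix (Fin n) (Fin m) ℝ} {w : Fin n ⊕ Fin m → Polynomial ℝ}
    (hw : polyDiffOp (pencilMatrix E A B) w = 0) :
    IsStateTrajectory E A B (fun t j => (w (.inr j)).eval t) (fun t i => (w (.inl i)).eval t) := by
  have hd : ∀ t : ℝ, HasDerivAt (fun s => E.mulVec fun i => (w (.inl i)).eval s)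
      (A.mulVec (fun i => (w (.inl i)).eval t) + B.mulVec (fun j => (w (.inr j)).eval t)) t := by
    intro t
    rw [hasDerivAt_pi]
    intro i
    have h0 := congrArg (Polynomial.eval t) (congrFun hw i)
    rw [polyDiffOp_pencilMatrix] at h0
    simp only [Polynomial.eval_sub, Polynomial.eval_finsetSum, Polynomial.eval_mul,
      Polynomial.eval_C, Pi.zero_apply, Polynomial.eval_zero] at h0
    have h1 := HasDerivAt.fun_sum (u := Finset.univ)
      fun j (_ : j ∈ Finset.univ) => ((w (.inl j)).hasDerivAt t).const_mul (E i j)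
    refine h1.congr_deriv ?_
    simp only [Pi.add_apply, Matrix.mulVec, dotProduct]
    linarith
  exact ⟨fun t _ => (hd t).continuousAt.continuousWithinAt, fun t _ => (hd t).hasDerivWithinAt⟩

/-- The rank conditions imply controllability; the input and the state trajectory are polynomial. -/
theorem isControllableDescriptor_of_rank {n m : ℕ} {E A : Matrix (Fin n) (Fin n) ℝ}
    {B : Matrix (Fin n) (Fin m) ℝ} (hEB : (Matrix.fromCols E B).rank = n)
    (hAB : ∀ l : ℂ,
      (Matrix.fromCols (complexify A - l • complexify E) (complexify B)).rank = n) :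
    IsControllableDescriptor E A B := by
  intro T hT x₀ x₁
  obtain ⟨R, hR⟩ := exists_pencilMatrix_mul_eq_one E A B hAB
  obtain ⟨w, hw, h0, h1⟩ := exists_polyDiffOp_pencilMatrix_eq_zero E A B
    (exists_mulVec_sub_mulVec hEB) hR hT.ne x₀ x₁
  -- A polynomial input is smooth to every order, so the value of the index does not matter.
  exact ⟨_, isPiecewiseContDiff_of_contDiff
    (contDiff_pi.2 fun j => by simpa using (w (.inr j)).contDiff_aeval (𝕜 := ℝ) _), _, isStateTrajectory_eval hw,
    funext h0, funext h1⟩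

theorem mainTheorem3 (n m : ℕ) (PE PA : PatternMatrix (Fin n) (Fin n))
    (PB : PatternMatrix (Fin n) (Fin m)) :
    ((∀ E ∈ patternClass PE, ∀ A ∈ patternClass PA, ∀ B ∈ patternClass PB, ∀ l : ℂ,
        (Matrix.fromCols E B).rank = n ∧
        (Matrix.fromCols (complexify A - l • complexify E) (complexify B)).rank = n) ↔
      (PatternMatrix.HasFullRowRank (Matrix.fromCols PE PB) ∧
       PatternMatrix.HasFullRowRank (Matrix.fromCols PA PB) ∧
       PatternMatrix.HasFullRowRank (Matrix.fromCols (PA + PE) PB))) ∧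
    (PatternMatrix.HasFullRowRank (Matrix.fromCols PE PB) ∧
       PatternMatrix.HasFullRowRank (Matrix.fromCols PA PB) ∧
       PatternMatrix.HasFullRowRank (Matrix.fromCols (PA + PE) PB) →
      IsRegularlyStronglyStructurallyControllable PE PA PB) := by
  have hiff := rank_conditions_iff_hasFullRowRank n m PE PA PB
  refine ⟨hiff, fun h E hE A hA B hB _ => ?_⟩
  have hrank := hiff.2 h E hE A hA B hB
  exact isControllableDescriptor_of_rank (hrank 0).1 fun l => (hrank l).2
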